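/- Let $X$ be a complex vector space and write $\mathbb M_n(X)$ for the $n\times n$ matrices over $X$, $\mathbb M_{m,n}(\mathbb C)$ for the complex $m\times n$ matrices, and $\|\cdot\|$ for the operator norm of complex matrices with respect to the Euclidean norms. Suppose $(X,\mathcal O_n)$ is an operator space, i.e. each $\mathcal O_n$ ($n\in\mathbb N$) is a norm on $\mathbb M_n(X)$ and $$\mathcal O_{m+n}\begin{pmatrix}x&0\\0&y\end{pmatrix}=\max\{\mathcal O_m(x),\mathcal O_n(y)\},\qquad \mathcal O_n(\alpha x\beta)\le\|\alpha\|\,\mathcal O_m(x)\,\|\beta\|$$ for all $x\in\mathbb M_m(X)$, $y\in\mathbb M_n(X)$, $\alpha\in\mathbb M_{n,m}(\mathbb C)$, $\beta\in\mathbb M_{m,n}(\mathbb C)$. A numerical radius norm affiliated with $(X,\mathcal O_n)$ is a sequence of norms $\mathcal W_n$ on $\mathbb M_n(X)$ ($n\in\mathbb N$) such that (WI) $\mathcal W_{m+n}\begin{pmatrix}x&0\\0&y\end{pmatrix}=\max\{\mathcal W_m(x),\mathcal W_n(y)\}$, (WII) $\mathcal W_n(\alpha x\alpha^*)\le\|\alpha\|^2\,\mathcal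 W_m(x)$, (OW) $\tfrac12\mathcal O_n(z)=\mathcal W_{2n}\begin{pmatrix}0&z\\0&0\end{pmatrix}$ for all $m,n\in\mathbb N$, $x\in\mathbb M_m(X)$, $y,z\in\mathbb M_n(X)$, $\alpha\in\mathbb M_{n,m}(\mathbb C)$. For $x\in\mathbb M_n(X)$ put $$\mathcal W_{\max,n}(x)=\inf\ \tfrac12\|aa^*+b^*b\|,$$ the infimum being over all $r\in\mathbb N$, $a\in\mathbb M_{n,r}(\mathbb C)$, $y\in\mathbb M_r(X)$, $b\in\mathbb M_{r,n}(\mathbb C)$ with $x=ayb$ and $\mathcal O_r(y)=1$ (if $X=\{0\}$, where no such $y$ exists, put $\mathcal W_{\max,n}=0$). Then $(\mathcal W_{\max,n})_n$ is a numerical radius norm affiliated with $(X,\mathcal O_n)$, and it is the largest one: every numerical radius norm $(\mathcal W_n)_n$ affiliated with $(X,\mathcal O_n)$ satisfies $\mathcal W_n(x)\le\mathcal W_{\max,n}(x)$ for all $n\in\mathbb N$ and $x\in\mathbb M_n(X)$. -/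

import Mathlib

/- The norm `‖a‖` of a rectangular complex matrix is its operator norm between Euclidean spaces. -/
open scoped Matrix Matrix.Norms.L2Operator

noncomputable section

namespace NumRadius

/-- `p` is a norm on the complex vector space `E`. -/
structure IsNorm {E : Type*} [AddCommGroup E] [Module ℂ E] (p : E → ℝ) : Prop where
  nonneg : ∀ x, 0 ≤ p x
  add_le : ∀ x y, p (x + y) ≤ p x + p y
  smul : ∀ (c : ℂ) (x), p (c • x) = ‖c‖ * p x
  eq_zero : ∀ x, p x = 0 → x = 0

/-- The product `a x b` of a matrix `x` over `X` with scalar matrices `a`, `b`. -/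
def sandwich {X : Type*} [AddCommGroup X] [Module ℂ X] {m n : ℕ}
    (a : Matrix (Fin n) (Fin m) ℂ) (x : Matrix (Fin m) (Fin m) X)
    (b : Matrix (Fin m) (Fin n) ℂ) : Matrix (Fin n) (Fin n) X :=
  Matrix.of fun i j => ∑ k, ∑ l, (a i k * b l j) • x k l

/-- The block diagonal matrix `[[x, 0], [0, y]]` of size `m + n`. -/
def diagBlock {X : Type*} [AddCommGroup X] {m n : ℕ}
    (x : Matrix (Fin m) (Fin m) X) (y : Matrix (Fin n) (Fin n) X) :
    Matrix (Fin (m + n)) (Fin (m + n)) X :=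
  Matrix.reindex finSumFinEquiv finSumFinEquiv (Matrix.fromBlocks x 0 0 y)

/-- The matrix `[[0, x], [0, 0]]` of size `n + n`. -/
def cornerBlock {X : Type*} [AddCommGroup X] {n : ℕ}
    (x : Matrix (Fin n) (Fin n) X) : Matrix (Fin (n + n)) (Fin (n + n)) X :=
  Matrix.reindex finSumFinEquiv finSumFinEquiv (Matrix.fromBlocks 0 x 0 0)

/-- `(X, O)` is an abstract operator space (Ruan's axioms).  The size `n = 0` is harmless: a norm
on the zero space of `0 × 0` matrices vanishes. -/
structure IsOperatorSpace {X : Type*} [AddCommGroup X] [Module ℂ X]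
    (O : ∀ n : ℕ, Matrix (Fin n) (Fin n) X → ℝ) : Prop where
  isNorm : ∀ n, IsNorm (O n)
  block : ∀ (m n : ℕ) (x : Matrix (Fin m) (Fin m) X) (y : Matrix (Fin n) (Fin n) X),
    O (m + n) (diagBlock x y) = max (O m x) (O n y)
  mul_le : ∀ (m n : ℕ) (α : Matrix (Fin n) (Fin m) ℂ) (x : Matrix (Fin m) (Fin m) X)
    (β : Matrix (Fin m) (Fin n) ℂ), O n (sandwich α x β) ≤ ‖α‖ * O m x * ‖β‖

/-- `(X, W)` is an abstract numerical radius operator space (axioms WI and WII). -/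
structure IsNumRadiusOperatorSpace {X : Type*} [AddCommGroup X] [Module ℂ X]
    (W : ∀ n : ℕ, Matrix (Fin n) (Fin n) X → ℝ) : Prop where
  isNorm : ∀ n, IsNorm (W n)
  block : ∀ (m n : ℕ) (x : Matrix (Fin m) (Fin m) X) (y : Matrix (Fin n) (Fin n) X),
    W (m + n) (diagBlock x y) = max (W m x) (W n y)
  mul_le : ∀ (m n : ℕ) (α : Matrix (Fin n) (Fin m) ℂ) (x : Matrix (Fin m) (Fin m) X),
    W n (sandwich α x αᴴ) ≤ ‖α‖ ^ 2 * W m x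

/-- `W` is a numerical radius norm affiliated with `(X, O)`: WI, WII and (OW) hold. -/
structure IsAffiliated {X : Type*} [AddCommGroup X] [Module ℂ X]
    (O W : ∀ n : ℕ, Matrix (Fin n) (Fin n) X → ℝ) : Prop
    extends IsNumRadiusOperatorSpace W where
  corner : ∀ (n : ℕ) (x : Matrix (Fin n) (Fin n) X),
    (1 / 2 : ℝ) * O n x = W (n + n) (cornerBlock x)

/-- The infimum of `½ ‖a a* + b* b‖` over all factorizations `x = a y b` with `O(y) = 1`.
If `X = {0}` there is no such `y`, and the value is `0`. -/
def Wmax {X : Type*} [AddCommGroup X] [Module ℂ X]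
    (O : ∀ n : ℕ, Matrix (Fin n) (Fin n) X → ℝ) (n : ℕ) (x : Matrix (Fin n) (Fin n) X) : ℝ :=
  sInf {t : ℝ | ∃ (r : ℕ) (a : Matrix (Fin n) (Fin r) ℂ) (y : Matrix (Fin r) (Fin r) X)
    (b : Matrix (Fin r) (Fin n) ℂ), x = sandwich a y b ∧ O r y = 1 ∧
      t = (1 / 2 : ℝ) * ‖a * aᴴ + bᴴ * b‖}

end NumRadius

end

/-! Maximality: for the row `α = [a, bᴴ]` one has `α [[0, y], [0, 0]] αᴴ = a y b` and `α αᴴ = a aᴴ +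
bᴴ b`. Hence WII and OW force `W (a y b) ≤ ½ ‖a aᴴ + bᴴ b‖ O y` for every affiliated `W`
(`IsAffiliated.sandwich_le`), and `Wmax` is the infimum of these bounds.

That `Wmax` is itself affiliated comes from gluing two factorizations along a block diagonal middle
factor, whose `O`-norm is a maximum. The Gram matrices `a aᴴ + bᴴ b` then add up (`Wmax_add_le`) or
form a block diagonal (`Wmax_diagBlock`). The bound `‖a‖ ‖b‖ ≤ ‖a aᴴ + bᴴ b‖` gives `½ O ≤ Wmax`,
hence definiteness and one half of OW; the other half is a factorization of the corner with Gram
matrix `1`. -/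

namespace NumRadius

open scoped MatrixOrder ComplexOrder

variable {X : Type*} [AddCommGroup X] [Module ℂ X]

/-! ### Algebra of the products `a x b`. -/

section Sandwich

variable {m n k : ℕ}

theorem sandwich_apply (a : Matrix (Fin n) (Fin m) ℂ) (x : Matrix (Fin m) (Fin m) X)
    (b : Matrix (Fin m) (Fin n) ℂ) (i j : Fin n) :
    sandwich a x b i j = ∑ k, ∑ l, (a i k * b l j) • x k l := rfl

theorem sandwich_add (a : Matrix (Fin n) (Fin m) ℂ) (x y : Matrix (Fin m) (Fin m) X)
    (b : Matrix (Fin m) (Fin n) ℂ) :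
    sandwich a (x + y) b = sandwich a x b + sandwich a y b := by
  ext i j
  simp [sandwich_apply, Finset.sum_add_distrib]

theorem sandwich_smul (a : Matrix (Fin n) (Fin m) ℂ) (c : ℂ) (x : Matrix (Fin m) (Fin m) X)
    (b : Matrix (Fin m) (Fin n) ℂ) :
    sandwich a (c • x) b = c • sandwich a x b := by
  ext i j
  simp [sandwich_apply, Finset.smul_sum, smul_smul, mul_comm]

theorem smul_sandwich (c : ℂ) (a : Matrix (Fin n) (Fin m) ℂ) (x : Matrix (Fin m) (Fin m) X)
    (b : Matrix (Fin m) (Fin n) ℂ) :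
    sandwich (c • a) x b = c • sandwich a x b := by
  ext i j
  simp [sandwich_apply, Finset.smul_sum, smul_smul, mul_assoc]

theorem sandwich_smul_right (c : ℂ) (a : Matrix (Fin n) (Fin m) ℂ) (x : Matrix (Fin m) (Fin m) X)
    (b : Matrix (Fin m) (Fin n) ℂ) :
    sandwich a x (c • b) = c • sandwich a x b := by
  ext i j
  simp [sandwich_apply, Finset.smul_sum, smul_smul, mul_left_comm]

@[simp] theorem zero_sandwich (x : Matrix (Fin m) (Fin m) X) (b : Matrix (Fin m) (Fin n) ℂ) :
    sandwich (0 : Matrix (Fin n) (Fin m) ℂ) x b = 0 := by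
  ext i j
  simp [sandwich_apply]

@[simp] theorem sandwich_zero (a : Matrix (Fin n) (Fin m) ℂ) (b : Matrix (Fin m) (Fin n) ℂ) :
    sandwich a (0 : Matrix (Fin m) (Fin m) X) b = 0 := by
  ext i j
  simp [sandwich_apply]

@[simp] theorem one_sandwich_one (x : Matrix (Fin m) (Fin m) X) : sandwich 1 x 1 = x := by
  ext i j
  simp [sandwich_apply, Matrix.one_apply, ite_smul]

theorem sandwich_sandwich (a : Matrix (Fin n) (Fin m) ℂ) (b : Matrix (Fin m) (Fin k) ℂ)
    (x : Matrix (Fin k) (Fin k) X) (c : Matrix (Fin k) (Fin m) ℂ) (d : Matrix (Fin m) (Fin n) ℂ) :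
    sandwich a (sandwich b x c) d = sandwich (a * b) x (c * d) := by
  ext i j
  simp only [sandwich_apply, Matrix.mul_apply, Finset.smul_sum, Finset.sum_mul, Finset.mul_sum,
    Finset.sum_smul, smul_smul]
  conv_lhs =>
    enter [2, p]
    rw [Finset.sum_comm]
    enter [2, u]
    rw [Finset.sum_comm]
  rw [Finset.sum_comm]
  refine Finset.sum_congr rfl fun u _ => ?_
  rw [Finset.sum_comm]
  refine Finset.sum_congr rfl fun v _ => ?_
  rw [Finset.sum_comm]
  refine Finset.sum_congr rfl fun l _ => Finset.sum_congr rfl fun p _ => ?_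
  congr 1
  ring

end Sandwich

/-! ### Coordinate isometries and block matrices. -/

section Inclusions

/-- The isometry of `ℂᵐ` onto the first summand of `ℂᵐ ⊕ ℂⁿ`. -/
def incl₁ (m n : ℕ) : Matrix (Fin (m + n)) (Fin m) ℂ :=
  (1 : Matrix (Fin (m + n)) (Fin (m + n)) ℂ).submatrix id (Fin.castAdd n)

/-- The isometry of `ℂⁿ` onto the second summand of `ℂᵐ ⊕ ℂⁿ`. -/
def incl₂ (m n : ℕ) : Matrix (Fin (m + n)) (Fin n) ℂ :=
  (1 : Matrix (Fin (m + n)) (Fin (m + n)) ℂ).submatrix id (Fin.natAdd m)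

variable (m n : ℕ)

@[simp] theorem incl₁_conjTranspose_mul_incl₁ : (incl₁ m n)ᴴ * incl₁ m n = 1 := by
  ext i j
  simp [incl₁, Matrix.mul_apply, Matrix.one_apply, apply_ite]

@[simp] theorem incl₂_conjTranspose_mul_incl₂ : (incl₂ m n)ᴴ * incl₂ m n = 1 := by
  ext i j
  simp [incl₂, Matrix.mul_apply, Matrix.one_apply, apply_ite]

theorem castAdd_ne_natAdd {m n : ℕ} (i : Fin m) (j : Fin n) : Fin.castAdd n i ≠ Fin.natAdd m j := by
  intro h
  have := congrArg Fin.val h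
  simp at this
  omega

@[simp] theorem incl₁_conjTranspose_mul_incl₂ : (incl₁ m n)ᴴ * incl₂ m n = 0 := by
  ext i j
  simp [incl₁, incl₂, Matrix.mul_apply, Matrix.one_apply, apply_ite, castAdd_ne_natAdd]

@[simp] theorem incl₂_conjTranspose_mul_incl₁ : (incl₂ m n)ᴴ * incl₁ m n = 0 := by
  rw [← Matrix.conjTranspose_conjTranspose (incl₁ m n), ← Matrix.conjTranspose_mul,
    incl₁_conjTranspose_mul_incl₂, Matrix.conjTranspose_zero]

theorem incl_mul_conjTranspose_add :
    incl₁ m n * (incl₁ m n)ᴴ + incl₂ m n * (incl₂ m n)ᴴ = 1 := by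
  ext i j
  refine Fin.addCases (fun i => ?_) (fun i => ?_) i <;>
  refine Fin.addCases (fun j => ?_) (fun j => ?_) j <;>
  simp [incl₁, incl₂, Matrix.mul_apply, Matrix.one_apply, apply_ite, castAdd_ne_natAdd,
    (castAdd_ne_natAdd _ _).symm]

/-- Equality fails for `k = 0`, where the identity is the zero matrix. -/
theorem norm_one_le (k : ℕ) : ‖(1 : Matrix (Fin k) (Fin k) ℂ)‖ ≤ 1 := by
  have h := Matrix.l2_opNorm_conjTranspose_mul_self (1 : Matrix (Fin k) (Fin k) ℂ)
  simp only [Matrix.conjTranspose_one, mul_one] at h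
  nlinarith

theorem norm_le_one_of_isometry {m n : ℕ} {a : Matrix (Fin m) (Fin n) ℂ} (h : aᴴ * a = 1) :
    ‖a‖ ≤ 1 := by
  have h' := Matrix.l2_opNorm_conjTranspose_mul_self a
  rw [h] at h'
  nlinarith [norm_one_le n, norm_nonneg a]

theorem norm_incl₁_le : ‖incl₁ m n‖ ≤ 1 := norm_le_one_of_isometry (by simp)

theorem norm_incl₂_le : ‖incl₂ m n‖ ≤ 1 := norm_le_one_of_isometry (by simp)

variable {m n}

theorem diagBlock_eq (x : Matrix (Fin m) (Fin m) X) (y : Matrix (Fin n) (Fin n) X) :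
    diagBlock x y = sandwich (incl₁ m n) x (incl₁ m n)ᴴ + sandwich (incl₂ m n) y (incl₂ m n)ᴴ := by
  ext i j
  refine Fin.addCases (fun i => ?_) (fun i => ?_) i <;>
  refine Fin.addCases (fun j => ?_) (fun j => ?_) j <;>
  simp [diagBlock, sandwich_apply, incl₁, incl₂, Matrix.one_apply, apply_ite, ite_smul,
    castAdd_ne_natAdd, (castAdd_ne_natAdd _ _).symm]

theorem cornerBlock_eq (x : Matrix (Fin n) (Fin n) X) :
    cornerBlock x = sandwich (incl₁ n n) x (incl₂ n n)ᴴ := by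
  ext i j
  refine Fin.addCases (fun i => ?_) (fun i => ?_) i <;>
  refine Fin.addCases (fun j => ?_) (fun j => ?_) j <;>
  simp [cornerBlock, sandwich_apply, incl₁, incl₂, Matrix.one_apply, apply_ite, ite_smul,
    (castAdd_ne_natAdd _ _).symm, -Fin.natAdd_eq_addNat]

theorem sandwich_diagBlock {k : ℕ} (a : Matrix (Fin k) (Fin (m + n)) ℂ)
    (x : Matrix (Fin m) (Fin m) X) (y : Matrix (Fin n) (Fin n) X)
    (b : Matrix (Fin (m + n)) (Fin k) ℂ) :
    sandwich a (diagBlock x y) b = sandwich (a * incl₁ m n) x ((incl₁ m n)ᴴ * b) +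
      sandwich (a * incl₂ m n) y ((incl₂ m n)ᴴ * b) := by
  rw [diagBlock_eq, sandwich_add, sandwich_sandwich, sandwich_sandwich]

theorem compress₁_diagBlock (x : Matrix (Fin m) (Fin m) X) (y : Matrix (Fin n) (Fin n) X) :
    sandwich (incl₁ m n)ᴴ (diagBlock x y) (incl₁ m n) = x := by
  simp [sandwich_diagBlock]

theorem compress₂_diagBlock (x : Matrix (Fin m) (Fin m) X) (y : Matrix (Fin n) (Fin n) X) :
    sandwich (incl₂ m n)ᴴ (diagBlock x y) (incl₂ m n) = y := by
  simp [sandwich_diagBlock]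

end Inclusions

/-! ### Norm estimates from the Loewner order. -/

section MatrixNorm

variable {m n r s : ℕ}

theorem conjTranspose_mul_self_nonneg (a : Matrix (Fin m) (Fin n) ℂ) : 0 ≤ aᴴ * a :=
  (Matrix.posSemidef_conjTranspose_mul_self a).nonneg

theorem mul_conjTranspose_self_nonneg (a : Matrix (Fin m) (Fin n) ℂ) : 0 ≤ a * aᴴ :=
  (Matrix.posSemidef_self_mul_conjTranspose a).nonneg

theorem gram_nonneg (a : Matrix (Fin n) (Fin r) ℂ) (b : Matrix (Fin s) (Fin n) ℂ) :
    0 ≤ a * aᴴ + bᴴ * b :=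
  add_nonneg (mul_conjTranspose_self_nonneg a) (conjTranspose_mul_self_nonneg b)

/-- Both `‖a‖²` and `‖b‖²` are at most the right side by monotonicity of the norm on positive
matrices; AM-GM does the rest. -/
theorem norm_mul_norm_le (a : Matrix (Fin n) (Fin r) ℂ) (b : Matrix (Fin s) (Fin n) ℂ) :
    ‖a‖ * ‖b‖ ≤ ‖a * aᴴ + bᴴ * b‖ := by
  have ha : ‖a * aᴴ‖ ≤ ‖a * aᴴ + bᴴ * b‖ :=
    CStarAlgebra.norm_le_norm_of_nonneg_of_le (mul_conjTranspose_self_nonneg a)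
      (le_add_of_nonneg_right (conjTranspose_mul_self_nonneg b))
  have hb : ‖bᴴ * b‖ ≤ ‖a * aᴴ + bᴴ * b‖ :=
    CStarAlgebra.norm_le_norm_of_nonneg_of_le (conjTranspose_mul_self_nonneg b)
      (le_add_of_nonneg_left (mul_conjTranspose_self_nonneg a))
  have h := Matrix.l2_opNorm_conjTranspose_mul_self aᴴ
  rw [Matrix.conjTranspose_conjTranspose, Matrix.l2_opNorm_conjTranspose] at h
  rw [h] at ha
  rw [Matrix.l2_opNorm_conjTranspose_mul_self] at hb
  nlinarith [sq_nonneg (‖a‖ - ‖b‖)]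

/-- For positive matrices a norm bound by `t` is an order bound by `t • 1`. The range projections of
the two inclusions sum to `1`, so `t • 1` minus the block matrix is a sum of two conjugated positive
matrices. -/
theorem norm_block_le {M : Matrix (Fin m) (Fin m) ℂ} {N : Matrix (Fin n) (Fin n) ℂ}
    (hM : 0 ≤ M) (hN : 0 ≤ N) {t : ℝ} (hMt : ‖M‖ ≤ t) (hNt : ‖N‖ ≤ t) :
    ‖incl₁ m n * M * (incl₁ m n)ᴴ + incl₂ m n * N * (incl₂ m n)ᴴ‖ ≤ t := by
  have ht : 0 ≤ t := (norm_nonneg M).trans hMt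
  have hM' := Matrix.le_iff.1 ((CStarAlgebra.norm_le_iff_le_algebraMap M ht hM).1 hMt)
  have hN' := Matrix.le_iff.1 ((CStarAlgebra.norm_le_iff_le_algebraMap N ht hN).1 hNt)
  have h₁ := (Matrix.nonneg_iff_posSemidef.1 hM).mul_mul_conjTranspose_same (incl₁ m n)
  have h₂ := (Matrix.nonneg_iff_posSemidef.1 hN).mul_mul_conjTranspose_same (incl₂ m n)
  refine (CStarAlgebra.norm_le_iff_le_algebraMap _ ht (h₁.add h₂).nonneg).2 (Matrix.le_iff.2 ?_)
  have h := (hM'.mul_mul_conjTranspose_same (incl₁ m n)).add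
    (hN'.mul_mul_conjTranspose_same (incl₂ m n))
  have heq : algebraMap ℝ (Matrix (Fin (m + n)) (Fin (m + n)) ℂ) t -
      (incl₁ m n * M * (incl₁ m n)ᴴ + incl₂ m n * N * (incl₂ m n)ᴴ) =
      incl₁ m n * (algebraMap ℝ _ t - M) * (incl₁ m n)ᴴ +
        incl₂ m n * (algebraMap ℝ _ t - N) * (incl₂ m n)ᴴ := by
    simp only [Algebra.algebraMap_eq_smul_one, Matrix.mul_sub, Matrix.sub_mul, Matrix.mul_smul,
      Matrix.smul_mul, Matrix.mul_one]
    rw [← incl_mul_conjTranspose_add m n, smul_add]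
    abel
  rw [heq]
  exact h

end MatrixNorm

/-! ### Consequences of the norm axioms. -/

section NormAxioms

variable {E : Type*} [AddCommGroup E] [Module ℂ E] {p : E → ℝ}

theorem IsNorm.map_zero (hp : IsNorm p) : p 0 = 0 := by
  simpa using hp.smul 0 0

theorem IsNorm.pos (hp : IsNorm p) {x : E} (hx : x ≠ 0) : 0 < p x :=
  lt_of_le_of_ne (hp.nonneg x) fun h => hx (hp.eq_zero x h.symm)

theorem IsNorm.map_inv_smul_self (hp : IsNorm p) {x : E} (hx : x ≠ 0) :
    p (((p x)⁻¹ : ℂ) • x) = 1 := by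
  have := hp.pos hx
  rw [hp.smul, norm_inv, Complex.norm_real, Real.norm_of_nonneg this.le, inv_mul_cancel₀ this.ne']

end NormAxioms

/-! ### The norm axioms, WI, WII, OW and maximality for `Wmax`. -/

section Wmax

variable {O : ∀ n : ℕ, Matrix (Fin n) (Fin n) X → ℝ} {n r : ℕ}

theorem Wmax_nonneg (n : ℕ) (x : Matrix (Fin n) (Fin n) X) : 0 ≤ Wmax O n x := by
  refine Real.sInf_nonneg ?_
  rintro t ⟨r, a, y, b, -, -, rfl⟩
  positivity

theorem Wmax_le_of_eq_one (a : Matrix (Fin n) (Fin r) ℂ) {y : Matrix (Fin r) (Fin r) X}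
    (b : Matrix (Fin r) (Fin n) ℂ) (hy : O r y = 1) :
    Wmax O n (sandwich a y b) ≤ 1 / 2 * ‖a * aᴴ + bᴴ * b‖ := by
  refine csInf_le ⟨0, ?_⟩ ⟨r, a, y, b, rfl, hy, rfl⟩
  rintro t ⟨r, a, y, b, -, -, rfl⟩
  positivity

theorem Wmax_zero (n : ℕ) : Wmax O n 0 = 0 := by
  refine le_antisymm ?_ (Wmax_nonneg n 0)
  by_cases h : ∃ (r : ℕ) (y : Matrix (Fin r) (Fin r) X), O r y = 1
  · obtain ⟨r, y, hy⟩ := h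
    simpa using Wmax_le_of_eq_one (n := n) 0 0 hy
  -- With no `y` of norm one the infimum is over the empty set, and `sInf ∅ = 0` in `ℝ`.
  · refine (congrArg sInf (Set.eq_empty_of_forall_notMem ?_)).trans_le Real.sInf_empty.le
    rintro t ⟨r, a, y, b, -, hy, -⟩
    exact h ⟨r, y, hy⟩

/-- Frees the middle factor from its normalization: moving `√(O r y)` into each of `a` and `b`
multiplies the Gram matrix by `O r y`. -/
theorem Wmax_sandwich_le (hO : IsOperatorSpace O) (a : Matrix (Fin n) (Fin r) ℂ)
    (y : Matrix (Fin r) (Fin r) X) (b : Matrix (Fin r) (Fin n) ℂ) :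
    Wmax O n (sandwich a y b) ≤ 1 / 2 * (O r y * ‖a * aᴴ + bᴴ * b‖) := by
  by_cases hy : y = 0
  · simp [hy, Wmax_zero, (hO.isNorm r).map_zero]
  have hpos := (hO.isNorm r).pos hy
  set c := O r y with hc
  have hcs : (√c : ℂ) * √c = c := by
    rw [← Complex.ofReal_mul, Real.mul_self_sqrt hpos.le]
  have hc0 : (c : ℂ) ≠ 0 := by exact_mod_cast hpos.ne'
  have key := Wmax_le_of_eq_one ((√c : ℂ) • a) ((√c : ℂ) • b)
    ((hO.isNorm r).map_inv_smul_self hy)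
  rw [← hc, smul_sandwich, sandwich_smul_right, sandwich_smul, smul_smul, smul_smul,
    hcs, mul_inv_cancel₀ hc0, one_smul] at key
  convert key using 2
  simp only [Matrix.conjTranspose_smul, Matrix.smul_mul, Matrix.mul_smul, smul_smul,
    RCLike.star_def, Complex.conj_ofReal, hcs]
  rw [← smul_add, norm_smul, Complex.norm_real, Real.norm_of_nonneg hpos.le]

/-- Relaxing `O r y = 1` to `≤ 1` makes this valid also for `X = {0}`: zero factors through size `r
= 0`. -/
theorem exists_factorization_of_Wmax_lt (hO : IsOperatorSpace O) {x : Matrix (Fin n) (Fin n) X}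
    {t : ℝ} (h : Wmax O n x < t) :
    ∃ (r : ℕ) (a : Matrix (Fin n) (Fin r) ℂ) (y : Matrix (Fin r) (Fin r) X)
      (b : Matrix (Fin r) (Fin n) ℂ), x = sandwich a y b ∧ O r y ≤ 1 ∧
        1 / 2 * ‖a * aᴴ + bᴴ * b‖ < t := by
  by_cases hx : x = 0
  · exact ⟨0, 0, 0, 0, by simp [hx], by simp [(hO.isNorm 0).map_zero],
      by simpa using (Wmax_nonneg n x).trans_lt h⟩
  have hc0 : (O n x : ℂ) ≠ 0 := by exact_mod_cast ((hO.isNorm n).pos hx).ne'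
  -- This factorization shows that the infimum is over a nonempty set.
  have hfac : x = sandwich ((O n x : ℂ) • 1) ((O n x : ℂ)⁻¹ • x) 1 := by
    rw [smul_sandwich, sandwich_smul, smul_smul, mul_inv_cancel₀ hc0, one_smul, one_sandwich_one]
  obtain ⟨_, ⟨r, a, y, b, hxy, hy, rfl⟩, hlt⟩ := exists_lt_of_csInf_lt
    (by exact ⟨_, n, _, _, _, hfac, (hO.isNorm n).map_inv_smul_self hx, rfl⟩) h
  exact ⟨r, a, y, b, hxy, hy.le, hlt⟩

theorem half_le_Wmax (hO : IsOperatorSpace O) (x : Matrix (Fin n) (Fin n) X) :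
    1 / 2 * O n x ≤ Wmax O n x := by
  refine le_of_forall_gt_imp_ge_of_dense fun t ht => ?_
  obtain ⟨r, a, y, b, rfl, hy, hlt⟩ := exists_factorization_of_Wmax_lt hO ht
  have h₁ := hO.mul_le _ _ a y b
  have h₂ := norm_mul_norm_le a b
  have h₃ : ‖a‖ * O r y * ‖b‖ ≤ ‖a‖ * 1 * ‖b‖ := by gcongr
  linarith

theorem Wmax_sandwich_conjTranspose_le (hO : IsOperatorSpace O) {m : ℕ}
    (α : Matrix (Fin n) (Fin m) ℂ) (x : Matrix (Fin m) (Fin m) X) :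
    Wmax O n (sandwich α x αᴴ) ≤ ‖α‖ ^ 2 * Wmax O m x := by
  have key : ∀ t, Wmax O m x < t → Wmax O n (sandwich α x αᴴ) ≤ ‖α‖ ^ 2 * t := by
    intro t ht
    obtain ⟨r, a, y, b, rfl, hy, hlt⟩ := exists_factorization_of_Wmax_lt hO ht
    rw [sandwich_sandwich]
    refine (Wmax_sandwich_le hO _ _ _).trans ?_
    have hgram : α * a * (α * a)ᴴ + (b * αᴴ)ᴴ * (b * αᴴ) = α * (a * aᴴ + bᴴ * b) * αᴴ := by
      simp only [Matrix.conjTranspose_mul, Matrix.conjTranspose_conjTranspose, Matrix.mul_add,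
        Matrix.add_mul, Matrix.mul_assoc]
    have hnorm : ‖α * (a * aᴴ + bᴴ * b) * αᴴ‖ ≤ ‖α‖ * ‖a * aᴴ + bᴴ * b‖ * ‖α‖ := by
      refine (Matrix.l2_opNorm_mul _ _).trans ?_
      rw [Matrix.l2_opNorm_conjTranspose]
      gcongr
      exact Matrix.l2_opNorm_mul _ _
    rw [hgram]
    calc 1 / 2 * (O r y * ‖α * (a * aᴴ + bᴴ * b) * αᴴ‖)
        ≤ 1 / 2 * (1 * (‖α‖ * ‖a * aᴴ + bᴴ * b‖ * ‖α‖)) := by gcongr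
      _ = ‖α‖ ^ 2 * (1 / 2 * ‖a * aᴴ + bᴴ * b‖) := by ring
      _ ≤ ‖α‖ ^ 2 * t := by gcongr
  refine le_of_forall_pos_le_add fun ε hε => ?_
  have hd : 0 < ‖α‖ ^ 2 + 1 := by positivity
  -- The `+ 1` keeps the denominator positive when `α = 0`.
  have h := key (Wmax O m x + ε / (‖α‖ ^ 2 + 1)) (by linarith [div_pos hε hd])
  have h' : ‖α‖ ^ 2 * (ε / (‖α‖ ^ 2 + 1)) ≤ ε := by
    rw [mul_div_assoc', div_le_iff₀ hd]
    nlinarith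
  linarith

theorem Wmax_add_le (hO : IsOperatorSpace O) (x₁ x₂ : Matrix (Fin n) (Fin n) X) :
    Wmax O n (x₁ + x₂) ≤ Wmax O n x₁ + Wmax O n x₂ := by
  refine le_of_forall_pos_le_add fun ε hε => ?_
  obtain ⟨r, a, y, b, hx₁, hy, hlt⟩ := exists_factorization_of_Wmax_lt hO
    (lt_add_of_pos_right (Wmax O n x₁) (half_pos hε))
  obtain ⟨s, c, z, d, hx₂, hz, hlt'⟩ := exists_factorization_of_Wmax_lt hO
    (lt_add_of_pos_right (Wmax O n x₂) (half_pos hε))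
  -- The row `[a, c]` and the column `[b; d]` around `diag(y, z)`.
  have key := Wmax_sandwich_le hO (a * (incl₁ r s)ᴴ + c * (incl₂ r s)ᴴ) (diagBlock y z)
    (incl₁ r s * b + incl₂ r s * d)
  have hgram : (a * (incl₁ r s)ᴴ + c * (incl₂ r s)ᴴ) * (a * (incl₁ r s)ᴴ + c * (incl₂ r s)ᴴ)ᴴ +
      (incl₁ r s * b + incl₂ r s * d)ᴴ * (incl₁ r s * b + incl₂ r s * d) =
      (a * aᴴ + bᴴ * b) + (c * cᴴ + dᴴ * d) := by
    simp only [Matrix.conjTranspose_mul, Matrix.conjTranspose_add, Matrix.mul_add, Matrix.add_mul,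
      Matrix.conjTranspose_conjTranspose, Matrix.mul_assoc]
    -- Bracketing the products of inclusions lets orthogonality remove the cross terms.
    simp only [← Matrix.mul_assoc (incl₁ r s)ᴴ, ← Matrix.mul_assoc (incl₂ r s)ᴴ]
    simp
    abel
  rw [hgram, hO.block, sandwich_diagBlock] at key
  have hle : max (O r y) (O s z) * ‖(a * aᴴ + bᴴ * b) + (c * cᴴ + dᴴ * d)‖ ≤
      1 * (‖a * aᴴ + bᴴ * b‖ + ‖c * cᴴ + dᴴ * d‖) := by
    gcongr
    · exact max_le hy hz
    · exact norm_add_le _ _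
  have hsum : x₁ + x₂ = sandwich ((a * (incl₁ r s)ᴴ + c * (incl₂ r s)ᴴ) * incl₁ r s) y
      ((incl₁ r s)ᴴ * (incl₁ r s * b + incl₂ r s * d)) +
      sandwich ((a * (incl₁ r s)ᴴ + c * (incl₂ r s)ᴴ) * incl₂ r s) z
      ((incl₂ r s)ᴴ * (incl₁ r s * b + incl₂ r s * d)) := by
    rw [hx₁, hx₂]
    simp only [Matrix.add_mul, Matrix.mul_add, Matrix.mul_assoc]
    simp only [← Matrix.mul_assoc (incl₁ r s)ᴴ, ← Matrix.mul_assoc (incl₂ r s)ᴴ]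
    simp
  rw [hsum]
  linarith

theorem Wmax_smul_le (hO : IsOperatorSpace O) (c : ℂ) (x : Matrix (Fin n) (Fin n) X) :
    Wmax O n (c • x) ≤ ‖c‖ * Wmax O n x := by
  by_cases hc : c = 0
  · simp [hc, Wmax_zero]
  have hpos : 0 < ‖c‖ := norm_pos_iff.2 hc
  rw [← div_le_iff₀' hpos]
  refine le_of_forall_gt_imp_ge_of_dense fun t ht => ?_
  obtain ⟨r, a, y, b, rfl, hy, hlt⟩ := exists_factorization_of_Wmax_lt hO ht
  rw [div_le_iff₀' hpos, ← sandwich_smul]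
  refine (Wmax_sandwich_le hO _ _ _).trans ?_
  rw [(hO.isNorm r).smul]
  calc 1 / 2 * (‖c‖ * O r y * ‖a * aᴴ + bᴴ * b‖)
      ≤ 1 / 2 * (‖c‖ * 1 * ‖a * aᴴ + bᴴ * b‖) := by gcongr
    _ = ‖c‖ * (1 / 2 * ‖a * aᴴ + bᴴ * b‖) := by ring
    _ ≤ ‖c‖ * t := by gcongr

theorem isNorm_Wmax (hO : IsOperatorSpace O) (n : ℕ) : IsNorm (Wmax O n) where
  nonneg := Wmax_nonneg n
  add_le := Wmax_add_le hO
  smul c x := by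
    refine le_antisymm (Wmax_smul_le hO c x) ?_
    by_cases hc : c = 0
    · simp [hc, Wmax_zero]
    have h := Wmax_smul_le hO c⁻¹ (c • x)
    rw [smul_smul, inv_mul_cancel₀ hc, one_smul, norm_inv] at h
    rwa [← le_inv_mul_iff₀ (norm_pos_iff.2 hc)]
  eq_zero x hx := by
    have h := half_le_Wmax hO x
    exact (hO.isNorm n).eq_zero x (le_antisymm (by linarith) ((hO.isNorm n).nonneg x))

theorem Wmax_compress_le (hO : IsOperatorSpace O) {m : ℕ} {α : Matrix (Fin m) (Fin n) ℂ}
    (hα : ‖α‖ ≤ 1) (x : Matrix (Fin m) (Fin m) X) :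
    Wmax O n (sandwich αᴴ x α) ≤ Wmax O m x := by
  have h := Wmax_sandwich_conjTranspose_le hO αᴴ x
  rw [Matrix.conjTranspose_conjTranspose, Matrix.l2_opNorm_conjTranspose] at h
  refine h.trans (mul_le_of_le_one_left (Wmax_nonneg _ _) ?_)
  exact pow_le_one₀ (norm_nonneg _) hα

/-- For `≤`, the outer factors are glued as block diagonals too, so the norm of the Gram matrix is
bounded by a maximum rather than a sum. For `≥`, compress to either block. -/
theorem Wmax_diagBlock (hO : IsOperatorSpace O) (m n : ℕ) (x₁ : Matrix (Fin m) (Fin m) X)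
    (x₂ : Matrix (Fin n) (Fin n) X) :
    Wmax O (m + n) (diagBlock x₁ x₂) = max (Wmax O m x₁) (Wmax O n x₂) := by
  refine le_antisymm ?_ (max_le ?_ ?_)
  · refine le_of_forall_gt_imp_ge_of_dense fun t ht => ?_
    obtain ⟨r, a, y, b, rfl, hy, hlt⟩ :=
      exists_factorization_of_Wmax_lt hO ((le_max_left _ _).trans_lt ht)
    obtain ⟨s, c, z, d, rfl, hz, hlt'⟩ :=
      exists_factorization_of_Wmax_lt hO ((le_max_right _ _).trans_lt ht)
    have hdiag : diagBlock (sandwich a y b) (sandwich c z d) =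
        sandwich (incl₁ m n * a * (incl₁ r s)ᴴ + incl₂ m n * c * (incl₂ r s)ᴴ) (diagBlock y z)
          (incl₁ r s * b * (incl₁ m n)ᴴ + incl₂ r s * d * (incl₂ m n)ᴴ) := by
      rw [sandwich_diagBlock, diagBlock_eq, sandwich_sandwich, sandwich_sandwich]
      simp only [Matrix.add_mul, Matrix.mul_add, Matrix.mul_assoc]
      simp only [← Matrix.mul_assoc (incl₁ r s)ᴴ, ← Matrix.mul_assoc (incl₂ r s)ᴴ]
      simp
    have hgram : (incl₁ m n * a * (incl₁ r s)ᴴ + incl₂ m n * c * (incl₂ r s)ᴴ) *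
          (incl₁ m n * a * (incl₁ r s)ᴴ + incl₂ m n * c * (incl₂ r s)ᴴ)ᴴ +
        (incl₁ r s * b * (incl₁ m n)ᴴ + incl₂ r s * d * (incl₂ m n)ᴴ)ᴴ *
          (incl₁ r s * b * (incl₁ m n)ᴴ + incl₂ r s * d * (incl₂ m n)ᴴ) =
        incl₁ m n * (a * aᴴ + bᴴ * b) * (incl₁ m n)ᴴ +
          incl₂ m n * (c * cᴴ + dᴴ * d) * (incl₂ m n)ᴴ := by
      simp only [Matrix.conjTranspose_mul, Matrix.conjTranspose_add, Matrix.mul_add,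
        Matrix.add_mul, Matrix.conjTranspose_conjTranspose, Matrix.mul_assoc]
      simp only [← Matrix.mul_assoc (incl₁ r s)ᴴ, ← Matrix.mul_assoc (incl₂ r s)ᴴ]
      simp
      abel
    rw [hdiag]
    refine (Wmax_sandwich_le hO _ _ _).trans ?_
    rw [hgram, hO.block]
    have hnorm := norm_block_le (gram_nonneg a b) (gram_nonneg c d) (t := 2 * t)
      (by linarith) (by linarith)
    calc _ ≤ 1 / 2 * (1 * (2 * t)) := by
          gcongr
          exact max_le hy hz
      _ = t := by ring
  · simpa only [compress₁_diagBlock] using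
      Wmax_compress_le hO (norm_incl₁_le m n) (diagBlock x₁ x₂)
  · simpa only [compress₂_diagBlock] using
      Wmax_compress_le hO (norm_incl₂_le m n) (diagBlock x₁ x₂)

theorem Wmax_cornerBlock (hO : IsOperatorSpace O) (n : ℕ) (z : Matrix (Fin n) (Fin n) X) :
    1 / 2 * O n z = Wmax O (n + n) (cornerBlock z) := by
  have hz := (hO.isNorm n).nonneg z
  refine le_antisymm (le_trans ?_ (half_le_Wmax hO _)) ?_
  · have h := hO.mul_le _ _ (incl₁ n n)ᴴ (cornerBlock z) (incl₂ n n)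
    have hz' : sandwich (incl₁ n n)ᴴ (cornerBlock z) (incl₂ n n) = z := by
      simp [cornerBlock_eq, sandwich_sandwich]
    rw [hz', Matrix.l2_opNorm_conjTranspose] at h
    have hc := (hO.isNorm (n + n)).nonneg (cornerBlock z)
    have : ‖incl₁ n n‖ * O (n + n) (cornerBlock z) * ‖incl₂ n n‖ ≤
        1 * O (n + n) (cornerBlock z) * 1 := by
      gcongr
      exacts [norm_incl₁_le n n, norm_incl₂_le n n]
    linarith
  · rw [cornerBlock_eq]
    refine (Wmax_sandwich_le hO _ _ _).trans ?_
    -- The Gram matrix is the sum of the two range projections, hence `1`.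
    rw [Matrix.conjTranspose_conjTranspose, incl_mul_conjTranspose_add]
    gcongr
    exact mul_le_of_le_one_right hz (norm_one_le _)

theorem isAffiliated_Wmax (hO : IsOperatorSpace O) : IsAffiliated O (Wmax O) where
  isNorm := isNorm_Wmax hO
  block := Wmax_diagBlock hO
  mul_le _ _ := Wmax_sandwich_conjTranspose_le hO
  corner := Wmax_cornerBlock hO

/-- WII for the row `α = [a, bᴴ]` applied to the corner of `y`, whose `W`-norm OW prescribes. -/
theorem IsAffiliated.sandwich_le {W : ∀ n : ℕ, Matrix (Fin n) (Fin n) X → ℝ}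
    (hW : IsAffiliated O W) (a : Matrix (Fin n) (Fin r) ℂ) (y : Matrix (Fin r) (Fin r) X)
    (b : Matrix (Fin r) (Fin n) ℂ) :
    W n (sandwich a y b) ≤ ‖a * aᴴ + bᴴ * b‖ * (1 / 2 * O r y) := by
  set α := a * (incl₁ r r)ᴴ + bᴴ * (incl₂ r r)ᴴ with hα
  have hαstar : αᴴ = incl₁ r r * aᴴ + incl₂ r r * b := by simp [hα]
  have hx : sandwich α (cornerBlock y) αᴴ = sandwich a y b := by
    rw [cornerBlock_eq, sandwich_sandwich, hαstar, hα]
    simp only [Matrix.add_mul, Matrix.mul_add, Matrix.mul_assoc]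
    simp only [← Matrix.mul_assoc (incl₂ r r)ᴴ]
    simp
  have hgram : α * αᴴ = a * aᴴ + bᴴ * b := by
    rw [hαstar, hα]
    simp only [Matrix.add_mul, Matrix.mul_add, Matrix.mul_assoc]
    simp only [← Matrix.mul_assoc (incl₁ r r)ᴴ, ← Matrix.mul_assoc (incl₂ r r)ᴴ]
    simp
  have hnorm : ‖α * αᴴ‖ = ‖α‖ ^ 2 := by
    have h := Matrix.l2_opNorm_conjTranspose_mul_self αᴴ
    rwa [Matrix.conjTranspose_conjTranspose, Matrix.l2_opNorm_conjTranspose, ← sq] at h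
  rw [← hx, ← hgram, hnorm, hW.corner]
  exact hW.mul_le _ _ α (cornerBlock y)

theorem IsAffiliated.le_Wmax (hO : IsOperatorSpace O)
    {W : ∀ n : ℕ, Matrix (Fin n) (Fin n) X → ℝ} (hW : IsAffiliated O W)
    (x : Matrix (Fin n) (Fin n) X) : W n x ≤ Wmax O n x := by
  refine le_of_forall_gt_imp_ge_of_dense fun t ht => ?_
  obtain ⟨r, a, y, b, rfl, hy, hlt⟩ := exists_factorization_of_Wmax_lt hO ht
  refine (hW.sandwich_le a y b).trans ?_
  calc ‖a * aᴴ + bᴴ * b‖ * (1 / 2 * O r y) ≤ ‖a * aᴴ + bᴴ * b‖ * (1 / 2 * 1) := by gcongr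
    _ = 1 / 2 * ‖a * aᴴ + bᴴ * b‖ := by ring
    _ ≤ t := hlt.le

end Wmax

end NumRadius

theorem theorem3p2 {X : Type*} [AddCommGroup X] [Module ℂ X]
    (O : ∀ n : ℕ, Matrix (Fin n) (Fin n) X → ℝ) (hO : NumRadius.IsOperatorSpace O) :
    NumRadius.IsAffiliated O (NumRadius.Wmax O) ∧
      ∀ W : ∀ n : ℕ, Matrix (Fin n) (Fin n) X → ℝ, NumRadius.IsAffiliated O W →
        ∀ (n : ℕ) (x : Matrix (Fin n) (Fin n) X), W n x ≤ NumRadius.Wmax O n x :=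
  ⟨NumRadius.isAffiliated_Wmax hO, fun _ hW _ x => hW.le_Wmax hO x⟩
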